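/- Let $A$ be a finite set, let $F(A)$ be the free group on $A$ and $\widehat{F}(A)$ the free profinite group on $A$ (the profinite completion of $F(A)$). Let $\varphi$ be an endomorphism of $F(A)$, and let $\widehat{\varphi}$ be its unique extension to a continuous endomorphism of $\widehat{F}(A)$. Let $\widehat{\varphi}^{\omega}$ be the unique idempotent in the closure of $\{\widehat{\varphi}^{\,n} : n\ge 1\}$ in the monoid of continuous endomorphisms of $\widehat{F}(A)$, with the compact-open topology. The incidence matrix of $\varphi$ is $M(\varphi)\in\mathbb{Z}^{A\times A}$, $M(\varphi)_{a,b}=|\varphi(a)|_b$, where $|\cdot|_b\colon F(A)\to\mathbb{Z}$ is the group homomorphism that sends $b$ to $1$ and all other letters to $0$. Let $G$ be a profinite group with an $\omega$-presentation defined by $\varphi$, that is, $G$ is isomorphic, as a topological group, to $\widehat{F}(A)/N$, where $N$ is the closed normal subgroup of $\widehat{F}(A)$ generated by $\{\widehat{\varphi}^{\omega}(a)a^{-1} : a\in A\}$. If $|\det M(\varphi)|>1$, then $G$ is not a free profinite group (of any finite or infinite rank). -/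

import Mathlib

universe u v w

/-- The free profinite group on a finite set `A`: the profinite completion of the free group. -/
noncomputable abbrev FreeProfinite (A : Type v) : ProfiniteGrp.{v} :=
  ProfiniteGrp.ProfiniteCompletion.completion (GrpCat.of (FreeGroup A))

namespace FreeProfinite

/-- The letter `a`, as an element of the free profinite group on `A`. -/
noncomputable def letter {A : Type v} (a : A) : FreeProfinite A :=
  ProfiniteGrp.ProfiniteCompletion.etaFn (GrpCat.of (FreeGroup A)) (FreeGroup.of a)

/-- The profinite extension of an endomorphism `φ` of the free group on `A`: the continuous
endomorphism of the free profinite group on `A` that extends `φ`. -/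
noncomputable def extension {A : Type v} (φ : FreeGroup A →* FreeGroup A) :
    FreeProfinite A →ₜ* FreeProfinite A :=
  (ProfiniteGrp.profiniteCompletion.map (GrpCat.ofHom φ)).hom

end FreeProfinite

/-- The `n`-th power (for composition) of a continuous endomorphism of a topological group. -/
def ContinuousMonoidHom.iter {F : Type*} [Group F] [TopologicalSpace F]
    (ψ : F →ₜ* F) : ℕ → (F →ₜ* F)
  | 0 => ContinuousMonoidHom.id F
  | n + 1 => ψ.comp (ContinuousMonoidHom.iter ψ n)

/-- `χ` is the `ω`-power of the continuous endomorphism `ψ`: it is idempotent, and it lies in the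
closure of the set of the powers `ψ ^ n`, `n ≥ 1`, where the continuous endomorphisms carry the
compact-open topology. (If `F` is a finitely generated profinite group, there is exactly one
such `χ`.) -/
structure IsOmegaPower {F : Type*} [Group F] [TopologicalSpace F]
    (ψ χ : F →ₜ* F) : Prop where
  mem_closure : χ ∈ closure {θ : F →ₜ* F | ∃ n : ℕ, 1 ≤ n ∧ θ = ψ.iter n}
  idempotent : χ.comp χ = χ

/-- The closed normal subgroup of a topological group generated by a set `R`. -/
def closedNormalClosure {F : Type*} [Group F] [TopologicalSpace F] [IsTopologicalGroup F]
    (R : Set F) : Subgroup F :=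
  (Subgroup.normalClosure R).topologicalClosure

instance closedNormalClosure_normal {F : Type*} [Group F] [TopologicalSpace F]
    [IsTopologicalGroup F] (R : Set F) : (closedNormalClosure R).Normal :=
  Subgroup.is_normal_topologicalClosure _

/-- `⟨A ∣ R⟩` is a profinite presentation of `G` (with a finite set `A` of generators). -/
def IsProfinitePresentation (A : Type v) [Finite A] (R : Set (FreeProfinite A))
    (G : ProfiniteGrp.{u}) : Prop :=
  Nonempty (G ≃ₜ* (FreeProfinite A ⧸ closedNormalClosure R))

/-- The endomorphism `φ` of the free group on the finite set `A` defines an `ω`-presentation of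
`G`, that is, `G ≅ ⟨A ∣ ψ^ω(a) a⁻¹ (a ∈ A)⟩` where `ψ` is the profinite extension of `φ`. -/
def DefinesOmegaPresentation {A : Type v} [Finite A] (φ : FreeGroup A →* FreeGroup A)
    (G : ProfiniteGrp.{u}) : Prop :=
  ∃ χ : FreeProfinite A →ₜ* FreeProfinite A,
    IsOmegaPower (FreeProfinite.extension φ) χ ∧
    IsProfinitePresentation A
      (Set.range fun a : A => χ (FreeProfinite.letter a) * (FreeProfinite.letter a)⁻¹) G

/-- The homomorphism `|·|_b` from the free group on `A` to `ℤ` that extends the Kronecker delta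
at the letter `b`. -/
def letterCount {A : Type*} [DecidableEq A] (b : A) : FreeGroup A →* Multiplicative ℤ :=
  FreeGroup.lift fun a => Multiplicative.ofAdd (if a = b then 1 else 0)

/-- The incidence matrix of `φ`, with entries `M(φ) a b = |φ(a)|_b`. -/
def incidenceMatrix {A : Type*} [DecidableEq A] (φ : FreeGroup A →* FreeGroup A) :
    Matrix A A ℤ :=
  Matrix.of fun a b => Multiplicative.toAdd (letterCount b (φ (FreeGroup.of a)))

/-- `G` is the free profinite group on the pointed topological space `(X, x₀)`, with universal map
`ι`: every continuous map `f` from `X` to a profinite group with `f x₀ = 1` extends uniquely to a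
continuous homomorphism on `G`.

The free profinite group on a finite set, or on any set without topology, is the case where `X` is
that set with one more point `x₀`, and is discrete; for the free profinite group on a set
converging to `1`, `X` is the one-point compactification of the discrete set and `x₀` is the
point at infinity. Since profinite groups are inverse limits of finite groups, it does not matter
in which universe the profinite groups `P` are taken. -/
structure IsFreeProfiniteOn {X : Type w} [TopologicalSpace X] (x₀ : X)
    (G : ProfiniteGrp.{u}) (ι : X → G) : Prop where
  continuous : Continuous ι
  map_base : ι x₀ = 1
  existsUnique_lift : ∀ (P : ProfiniteGrp.{u}) (f : X → P), Continuous f → f x₀ = 1 →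
    ∃! ψ : G →ₜ* P, ∀ x, ψ (ι x) = f x

/-- `G` is a free profinite group: it is free profinite, of finite or infinite rank, on some
pointed space (which covers sets, sets converging to `1`, and profinite spaces). -/
def IsFreeProfiniteGroup (G : ProfiniteGrp.{u}) : Prop :=
  ∃ (X : Type w) (_ : TopologicalSpace X) (x₀ : X) (ι : X → G), IsFreeProfiniteOn x₀ G ι

/-! Count continuous homomorphisms from `G` to `ZMod p`, for each prime `p`. If `G` is free on a
pointed space, there are `p ^ k` of them, with `k` independent of `p`
(`exists_card_pointed_continuousMap_eq_pow`). From the `ω`-presentation, they correspond to the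
vectors fixed by an idempotent power of the incidence matrix mod `p`; these are all `p ^ |A|`
vectors exactly when the matrix is invertible mod `p`, that is, when `p` does not divide the
determinant (`DefinesOmegaPresentation.card_hom_zmod`). A nonzero nonunit determinant has both a
prime that divides it and a prime that does not, so `k = |A|` would both hold and fail. -/

open Topology TopologicalSpace

/-! ### Counting pointed maps to discrete spaces -/

section PointedMaps

/-- The map from `X` to the power set of its clopen sets, sending a point to the clopen sets
containing it. -/
def clopensContaining {X : Type*} [TopologicalSpace X] (x : X) : Clopens X → Prop :=
  fun U => x ∈ U

theorem isLocallyConstant_clopensContaining {X : Type*} [TopologicalSpace X] [Finite (Clopens X)] :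
    IsLocallyConstant (clopensContaining : X → Clopens X → Prop) := by
  rw [IsLocallyConstant.iff_eventually_eq]
  intro x
  have h : ∀ U : Clopens X, ∀ᶠ y in 𝓝 x, y ∈ U ↔ x ∈ U := by
    intro U
    by_cases hx : x ∈ U
    · filter_upwards [U.isClopen.isOpen.mem_nhds hx] with y hy
      exact iff_of_true hy hx
    · filter_upwards [U.isClopen.compl.isOpen.mem_nhds hx] with y hy
      exact iff_of_false hy hx
  filter_upwards [Filter.eventually_all.2 h] with y hy
  exact funext fun U => propext (hy U)

theorem ContinuousMap.apply_eq_of_clopensContaining_eq {X D : Type*} [TopologicalSpace X]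
    [TopologicalSpace D] [DiscreteTopology D] (f : C(X, D)) {x y : X}
    (h : clopensContaining x = clopensContaining y) : f x = f y := by
  have h' := congrFun h ⟨f ⁻¹' {f x}, (isClopen_discrete {f x}).preimage f.continuous⟩
  have hx : y ∈ (⟨f ⁻¹' {f x}, (isClopen_discrete {f x}).preimage f.continuous⟩ : Clopens X) :=
    h'.mp rfl
  exact hx.symm

/-- A clopen set is recovered from the two-valued map that is `d` on the side of `x₀` and `e` on the
other, together with whether it contains `x₀`. -/
theorem finite_clopens_of_finite_pointed {X D : Type*} [TopologicalSpace X] [TopologicalSpace D]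
    [Nontrivial D] (x₀ : X) (d : D) [Finite {f : C(X, D) // f x₀ = d}] :
    Finite (Clopens X) := by
  classical
  obtain ⟨e, he⟩ := exists_ne d
  let ind (U : Clopens X) : C(X, D) :=
    ⟨fun x => if (x ∈ U ↔ x₀ ∈ U) then d else e, by
      refine IsLocallyConstant.continuous ((IsLocallyConstant.iff_eventually_eq _).2 fun x => ?_)
      by_cases hx : x ∈ U
      · filter_upwards [U.isClopen.isOpen.mem_nhds hx] with y hy
        have hy' : y ∈ U := hy
        simp only [hx, hy']
      · filter_upwards [U.isClopen.compl.isOpen.mem_nhds hx] with y hy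
        have hy' : y ∉ U := hy
        simp only [hx, hy']⟩
  refine Finite.of_injective
    (fun U : Clopens X => ((⟨ind U, if_pos Iff.rfl⟩ : {f : C(X, D) // f x₀ = d}), x₀ ∈ U)) ?_
  intro U V h
  obtain ⟨h₁, h₂⟩ := Prod.mk.inj h
  ext x
  have hx : (if (x ∈ U ↔ x₀ ∈ U) then d else e) = if (x ∈ V ↔ x₀ ∈ V) then d else e :=
    DFunLike.congr_fun (Subtype.ext_iff.1 h₁) x
  change x ∈ U ↔ x ∈ V
  have h₂' : x₀ ∈ U ↔ x₀ ∈ V := iff_of_eq h₂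
  by_cases p : (x ∈ U ↔ x₀ ∈ U) <;> by_cases q : (x ∈ V ↔ x₀ ∈ V)
  · tauto
  · rw [if_pos p, if_neg q] at hx
    exact absurd hx.symm he
  · rw [if_neg p, if_pos q] at hx
    exact absurd hx he
  · tauto

/-- If `X` has finitely many clopen sets, then the number of pointed continuous maps from `X` to a
finite discrete space `D` is a power of the cardinality of `D`, with an exponent that depends
on `X` only. -/
theorem exists_card_pointed_continuousMap_eq_pow {X : Type*} [TopologicalSpace X]
    [Finite (Clopens X)] (x₀ : X) :
    ∃ k : ℕ, ∀ (D : Type) [TopologicalSpace D] [DiscreteTopology D] (d : D),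
      Nat.card {f : C(X, D) // f x₀ = d} = Nat.card D ^ k := by
  classical
  -- The classes of points not separated by clopen sets, without that of `x₀`: a pointed map is a
  -- free choice of one value on each.
  let S := {s : Clopens X → Prop // s ∈ Set.range (clopensContaining (X := X)) ∧
    s ≠ clopensContaining x₀}
  refine ⟨Nat.card S, fun D _ _ d => ?_⟩
  rw [← Nat.card_fun]
  refine Nat.card_congr (Equiv.ofBijective
    (fun f (s : S) => f.1 (Classical.choose s.2.1)) ⟨fun f g h => ?_, fun g => ?_⟩)
  · ext x
    by_cases hx : clopensContaining x = clopensContaining x₀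
    · rw [f.1.apply_eq_of_clopensContaining_eq hx, g.1.apply_eq_of_clopensContaining_eq hx,
        f.2, g.2]
    · have hs := Classical.choose_spec (⟨x, rfl⟩ : clopensContaining x ∈ Set.range _)
      have h' := congrFun h ⟨clopensContaining x, ⟨x, rfl⟩, hx⟩
      dsimp only at h'
      rwa [f.1.apply_eq_of_clopensContaining_eq hs, g.1.apply_eq_of_clopensContaining_eq hs] at h'
  · let F : (Clopens X → Prop) → D := fun s =>
      if h : s ∈ Set.range (clopensContaining (X := X)) ∧ s ≠ clopensContaining x₀
      then g ⟨s, h⟩ else d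
    refine ⟨⟨⟨F ∘ clopensContaining,
      (isLocallyConstant_clopensContaining.comp F).continuous⟩, ?_⟩, ?_⟩
    · exact dif_neg fun h => h.2 rfl
    · funext s
      change F (clopensContaining (Classical.choose s.2.1)) = g s
      rw [Classical.choose_spec s.2.1]
      exact dif_pos s.2

end PointedMaps

/-! ### Counting continuous homomorphisms -/

section Homs

/-- Copying the codomain into another universe does not change continuous homomorphisms. -/
def ContinuousMonoidHom.uliftEquiv (F : Type*) [Group F] [TopologicalSpace F]
    (K : Type) [Group K] [TopologicalSpace K] :
    (F →ₜ* ULift.{u} K) ≃ (F →ₜ* K) where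
  toFun θ := ⟨(MulEquiv.ulift (α := K)).toMonoidHom.comp θ.toMonoidHom,
    continuous_uliftDown.comp θ.continuous_toFun⟩
  invFun θ := ⟨(MulEquiv.ulift (α := K)).symm.toMonoidHom.comp θ.toMonoidHom,
    continuous_uliftUp.comp θ.continuous_toFun⟩
  left_inv _ := rfl
  right_inv _ := rfl

/-- The universal property, passed through `ULift` because it tests only profinite groups in the
universe of `G`. -/
theorem IsFreeProfiniteOn.card_hom {X : Type w} [TopologicalSpace X] {x₀ : X}
    {G : ProfiniteGrp.{u}} {ι : X → G} (h : IsFreeProfiniteOn x₀ G ι)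
    (K : Type) [Group K] [Finite K] [TopologicalSpace K] [DiscreteTopology K] :
    Nat.card (G →ₜ* K) = Nat.card {f : C(X, K) // f x₀ = 1} := by
  have lift : ∀ f : C(X, K), f x₀ = 1 → ∃! ψ : G →ₜ* ULift.{u} K, ∀ x, ψ (ι x) = ⟨f x⟩ :=
    fun f hf => h.existsUnique_lift (ProfiniteGrp.of (ULift.{u} K)) (fun x => ⟨f x⟩)
      (continuous_uliftUp.comp f.continuous) (congrArg ULift.up hf)
  refine Nat.card_congr (Equiv.ofBijective
    (fun ψ => ⟨⟨fun x => ψ (ι x), ψ.continuous_toFun.comp h.continuous⟩, ?_⟩)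
    ⟨fun ψ ψ' e => ?_, fun f => ?_⟩)
  · change ψ (ι x₀) = 1
    rw [h.map_base, map_one]
  · have e' : ∀ x, ψ (ι x) = ψ' (ι x) := fun x => DFunLike.congr_fun (Subtype.ext_iff.1 e) x
    apply (ContinuousMonoidHom.uliftEquiv G K).symm.injective
    refine (lift ⟨fun x => ψ (ι x), ψ.continuous_toFun.comp h.continuous⟩ ?_).unique
      (fun x => rfl) (fun x => ?_)
    · change ψ (ι x₀) = 1
      rw [h.map_base, map_one]
    · exact congrArg ULift.up (e' x).symm
  · obtain ⟨ψ, hψ, -⟩ := lift f.1 f.2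
    refine ⟨ContinuousMonoidHom.uliftEquiv G K ψ, ?_⟩
    ext x
    exact congrArg ULift.down (hψ x)

/-- Continuous homomorphisms on a quotient by a closed normal closure are the continuous
homomorphisms that kill the relators. -/
theorem card_hom_quotient_closedNormalClosure {F : Type*} [Group F] [TopologicalSpace F]
    [IsTopologicalGroup F] (R : Set F) (K : Type*) [Group K] [TopologicalSpace K] [T1Space K] :
    Nat.card ((F ⧸ closedNormalClosure R) →ₜ* K) =
      Nat.card {θ : F →ₜ* K // ∀ r ∈ R, θ r = 1} := by
  let π : F →ₜ* F ⧸ closedNormalClosure R :=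
    ⟨QuotientGroup.mk' (closedNormalClosure R), QuotientGroup.continuous_mk⟩
  have hπ : ∀ r ∈ R, π r = 1 := fun r hr =>
    (QuotientGroup.eq_one_iff r).2
      (Subgroup.le_topologicalClosure _ (Subgroup.subset_normalClosure hr))
  refine Nat.card_congr (Equiv.ofBijective (fun ψ => ⟨ψ.comp π, fun r hr => ?_⟩)
    ⟨fun ψ ψ' e => ?_, fun θ => ?_⟩)
  · change ψ (π r) = 1
    rw [hπ r hr, map_one]
  · ext x
    obtain ⟨y, rfl⟩ := QuotientGroup.mk_surjective x
    exact DFunLike.congr_fun (Subtype.ext_iff.1 e) y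
  · obtain ⟨θ, hθ⟩ := θ
    have hker : closedNormalClosure R ≤ θ.toMonoidHom.ker := by
      refine Subgroup.topologicalClosure_minimal _ (Subgroup.normalClosure_le_normal hθ) ?_
      exact isClosed_singleton.preimage θ.continuous_toFun
    refine ⟨⟨QuotientGroup.lift _ θ.toMonoidHom hker,
      θ.continuous_toFun.quotient_lift _⟩, ?_⟩
    ext x
    rfl

theorem card_hom_congr {G H : Type*} [Group G] [TopologicalSpace G] [Group H] [TopologicalSpace H]
    (e : G ≃ₜ* H) (K : Type*) [Group K] [TopologicalSpace K] :
    Nat.card (G →ₜ* K) = Nat.card (H →ₜ* K) := by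
  let f : G →ₜ* H := ⟨e.toMulEquiv.toMonoidHom, e.continuous_toFun⟩
  let g : H →ₜ* G := ⟨e.symm.toMulEquiv.toMonoidHom, e.symm.continuous_toFun⟩
  exact Nat.card_congr
    ⟨fun θ => θ.comp g, fun θ => θ.comp f,
      fun θ => ContinuousMonoidHom.ext fun x => congrArg θ (e.symm_apply_apply x),
      fun θ => ContinuousMonoidHom.ext fun x => congrArg θ (e.apply_symm_apply x)⟩

end Homs

/-! ### Homomorphisms on the free profinite group -/

namespace FreeProfinite

open CategoryTheory ProfiniteGrp ProfiniteCompletion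

variable {A : Type v}

/-- The canonical homomorphism from the free group to the free profinite group. -/
noncomputable def ofFreeGroup (A : Type v) : FreeGroup A →* FreeProfinite A :=
  (eta (GrpCat.of (FreeGroup A))).hom

theorem extension_ofFreeGroup (φ : FreeGroup A →* FreeGroup A) (g : FreeGroup A) :
    extension φ (ofFreeGroup A g) = ofFreeGroup A (φ g) :=
  ConcreteCategory.congr_hom (lift_eta (GrpCat.ofHom φ ≫ eta (GrpCat.of (FreeGroup A)))) g

theorem hom_ext_letter {K : Type*} [Group K] [TopologicalSpace K] [T2Space K]
    {θ θ' : FreeProfinite A →ₜ* K} (h : ∀ a, θ (letter a) = θ' (letter a)) : θ = θ' := by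
  have h' : θ.toMonoidHom.comp (ofFreeGroup A) = θ'.toMonoidHom.comp (ofFreeGroup A) :=
    FreeGroup.ext_hom _ _ h
  have := (denseRange (G := GrpCat.of (FreeGroup A))).equalizer θ.continuous_toFun
    θ'.continuous_toFun (funext fun g => DFunLike.congr_fun h' g)
  exact ContinuousMonoidHom.ext fun x => congrFun this x

theorem exists_hom_letter_eq {K : Type} [Group K] [Finite K] [TopologicalSpace K]
    [DiscreteTopology K] (f : A → K) :
    ∃ θ : FreeProfinite A →ₜ* K, ∀ a, θ (letter a) = f a := by
  let P : ProfiniteGrp.{v} := ProfiniteGrp.of (ULift.{v} K)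
  let g : FreeGroup A →* P := FreeGroup.lift fun a => (⟨f a⟩ : ULift.{v} K)
  let l : completion (GrpCat.of (FreeGroup A)) ⟶ P := lift (GrpCat.ofHom g)
  refine ⟨ContinuousMonoidHom.uliftEquiv _ K l.hom, fun a => ?_⟩
  have h : l.hom (ofFreeGroup A (FreeGroup.of a)) = g (FreeGroup.of a) :=
    ConcreteCategory.congr_hom (lift_eta (GrpCat.ofHom g)) (FreeGroup.of a)
  have h' : g (FreeGroup.of a) = (⟨f a⟩ : ULift.{v} K) := FreeGroup.lift_apply_of
  exact congrArg ULift.down (h.trans h')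

end FreeProfinite

/-! ### Action of the incidence matrix on homomorphisms -/

section Incidence

open FreeProfinite

variable {A : Type v} [Fintype A] [DecidableEq A]

/-- Both sides are homomorphisms in `g` that agree on letters. -/
theorem toAdd_hom_eq_sum_letterCount {R : Type*} [CommRing R]
    (h : FreeGroup A →* Multiplicative R) (g : FreeGroup A) :
    (h g).toAdd = ∑ b, ((letterCount b g).toAdd : R) * (h (FreeGroup.of b)).toAdd := by
  let h' : FreeGroup A →* Multiplicative R :=
    { toFun := fun g => Multiplicative.ofAdd
        (∑ b, ((letterCount b g).toAdd : R) * (h (FreeGroup.of b)).toAdd)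
      map_one' := by simp
      map_mul' := fun x y => by
        simp [add_mul, Finset.sum_add_distrib] }
  have : h = h' := by
    refine FreeGroup.ext_hom _ _ fun a => ?_
    apply Multiplicative.toAdd.injective
    change _ = ∑ b, ((letterCount b (FreeGroup.of a)).toAdd : R) * (h (FreeGroup.of b)).toAdd
    simp [letterCount]
  exact congrArg Multiplicative.toAdd (DFunLike.congr_fun this g)

/-- The vector of the values at the letters of a homomorphism to the additive group of a ring. -/
noncomputable def letterValues {R : Type*} [CommRing R] [TopologicalSpace R]
    (θ : FreeProfinite A →ₜ* Multiplicative R) : A → R :=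
  fun a => (θ (letter a)).toAdd

variable {R : Type*} [CommRing R] [TopologicalSpace R]

theorem letterValues_comp_extension (φ : FreeGroup A →* FreeGroup A)
    (θ : FreeProfinite A →ₜ* Multiplicative R) :
    letterValues (θ.comp (extension φ)) =
      ((incidenceMatrix φ).map (Int.cast : ℤ → R)).mulVec (letterValues θ) := by
  funext a
  change (θ (extension φ (ofFreeGroup A (FreeGroup.of a)))).toAdd = _
  rw [extension_ofFreeGroup]
  exact toAdd_hom_eq_sum_letterCount (θ.toMonoidHom.comp (ofFreeGroup A)) _

theorem letterValues_comp_iter (φ : FreeGroup A →* FreeGroup A) (n : ℕ)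
    (θ : FreeProfinite A →ₜ* Multiplicative R) :
    letterValues (θ.comp ((extension φ).iter n)) =
      (((incidenceMatrix φ).map (Int.cast : ℤ → R)) ^ n).mulVec (letterValues θ) := by
  induction n generalizing θ with
  | zero =>
    rw [pow_zero, Matrix.one_mulVec]
    rfl
  | succ n ih =>
    have := ih (θ.comp (extension φ))
    rw [letterValues_comp_extension, Matrix.mulVec_mulVec, ← pow_succ] at this
    exact this

/-- With values in a finite ring, an element of the closure of the powers acts on the values at the letters as a
power of the incidence matrix. -/
theorem exists_pow_letterValues_comp (φ : FreeGroup A →* FreeGroup A)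
    {χ : FreeProfinite A →ₜ* FreeProfinite A}
    (hχ : χ ∈ closure {θ | ∃ n : ℕ, 1 ≤ n ∧ θ = (extension φ).iter n})
    [Finite R] [DiscreteTopology R] :
    ∃ n : ℕ, 1 ≤ n ∧ ∀ θ : FreeProfinite A →ₜ* Multiplicative R,
      letterValues (θ.comp χ) =
        (((incidenceMatrix φ).map (Int.cast : ℤ → R)) ^ n).mulVec (letterValues θ) := by
  have hfin : Finite (FreeProfinite A →ₜ* Multiplicative R) :=
    Finite.of_injective (letterValues (A := A) (R := R)) fun θ θ' h =>
      hom_ext_letter fun a => congrFun h a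
  -- There are finitely many `θ`, so agreement with `χ` under all of them is an open condition, and
  -- one exponent `n` serves every `θ`.
  have hopen : IsOpen {σ : FreeProfinite A →ₜ* FreeProfinite A |
      ∀ (θ : FreeProfinite A →ₜ* Multiplicative R) (a : A),
        θ (σ (letter a)) = θ (χ (letter a))} := by
    simp only [Set.ofPred_forall]
    refine isOpen_iInter_of_finite fun θ => isOpen_iInter_of_finite fun a => ?_
    exact (isOpen_discrete {θ (χ (letter a))}).preimage
      (θ.continuous_toFun.comp (continuous_eval_const (letter a)))
  obtain ⟨σ, hσ, n, hn, rfl⟩ := mem_closure_iff.1 hχ _ hopen fun _ _ => rfl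
  refine ⟨n, hn, fun θ => ?_⟩
  rw [← letterValues_comp_iter]
  funext a
  exact congrArg Multiplicative.toAdd (hσ θ a).symm

/-- The number of homomorphisms to a finite ring of a group with an `ω`-presentation is the number
of fixed vectors of an idempotent power of the incidence matrix. -/
theorem DefinesOmegaPresentation.exists_card_hom {φ : FreeGroup A →* FreeGroup A}
    {G : ProfiniteGrp.{u}} (hG : DefinesOmegaPresentation φ G)
    (R : Type) [CommRing R] [TopologicalSpace R] [Finite R] [DiscreteTopology R] :
    ∃ n : ℕ, 1 ≤ n ∧ IsIdempotentElem (((incidenceMatrix φ).map (Int.cast : ℤ → R)) ^ n) ∧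
      Nat.card (G →ₜ* Multiplicative R) =
        Nat.card {v : A → R // (((incidenceMatrix φ).map (Int.cast : ℤ → R)) ^ n).mulVec v = v} := by
  obtain ⟨χ, ⟨hcl, hidem⟩, ⟨e⟩⟩ := hG
  obtain ⟨n, hn, hχ⟩ := exists_pow_letterValues_comp (R := R) φ hcl
  have hsurj : ∀ v : A → R, ∃ θ : FreeProfinite A →ₜ* Multiplicative R, letterValues θ = v :=
    fun v => (exists_hom_letter_eq fun a => Multiplicative.ofAdd (v a)).imp
      fun θ h => funext fun a => congrArg Multiplicative.toAdd (h a)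
  have hinj : Function.Injective
      (letterValues : (FreeProfinite A →ₜ* Multiplicative R) → A → R) := fun θ θ' h =>
    hom_ext_letter fun a => congrFun h a
  refine ⟨n, hn, ?_, ?_⟩
  -- Every vector is some `letterValues θ`, so idempotence of `χ` passes to the matrix.
  · refine Matrix.ext_of_mulVec_single fun b => ?_
    obtain ⟨θ, hθ⟩ := hsurj (Pi.single b 1)
    rw [← Matrix.mulVec_mulVec, ← hθ, ← hχ, ← hχ]
    exact congrArg (fun σ => letterValues (θ.comp σ)) hidem
  · rw [card_hom_congr e, card_hom_quotient_closedNormalClosure]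
    have key : ∀ θ : FreeProfinite A →ₜ* Multiplicative R,
        (∀ r ∈ Set.range fun a : A => χ (letter a) * (letter a)⁻¹, θ r = 1) ↔
        (((incidenceMatrix φ).map (Int.cast : ℤ → R)) ^ n).mulVec (letterValues θ) =
          letterValues θ := by
      intro θ
      rw [← hχ, Set.forall_mem_range, funext_iff]
      refine forall_congr' fun a => ?_
      rw [map_mul, map_inv, mul_inv_eq_one]
      exact Multiplicative.toAdd.injective.eq_iff.symm
    exact Nat.card_congr ((Equiv.ofBijective letterValues ⟨hinj, hsurj⟩).subtypeEquiv key)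

theorem DefinesOmegaPresentation.card_hom_zmod {φ : FreeGroup A →* FreeGroup A}
    {G : ProfiniteGrp.{u}} (hG : DefinesOmegaPresentation φ G) (p : ℕ) [Fact p.Prime] :
    Finite (G →ₜ* Multiplicative (ZMod p)) ∧
    (Nat.card (G →ₜ* Multiplicative (ZMod p)) = p ^ Fintype.card A ↔
      ¬ (p : ℤ) ∣ (incidenceMatrix φ).det) := by
  obtain ⟨n, hn, hidem, hcard⟩ := hG.exists_card_hom (ZMod p)
  set M := (incidenceMatrix φ).map (Int.cast : ℤ → ZMod p) with hM
  have hdet : M.det = ((incidenceMatrix φ).det : ZMod p) :=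
    ((Int.castRingHom (ZMod p)).map_det (incidenceMatrix φ)).symm
  have hfun : Nat.card (A → ZMod p) = p ^ Fintype.card A := by
    rw [Nat.card_fun, Nat.card_zmod, Nat.card_eq_fintype_card]
  have hunit : (¬ (p : ℤ) ∣ (incidenceMatrix φ).det) ↔ IsUnit M := by
    rw [Matrix.isUnit_iff_isUnit_det, isUnit_iff_ne_zero, hdet, Ne, ZMod.intCast_zmod_eq_zero_iff_dvd]
  have hfix : Nat.card {v : A → ZMod p // (M ^ n).mulVec v = v} = p ^ Fintype.card A ↔
      M ^ n = 1 := by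
    refine ⟨fun h => ?_, fun h => ?_⟩
    · have hall : ∀ v, (M ^ n).mulVec v = v := by
        have : Function.Surjective
            (Subtype.val : {v : A → ZMod p // (M ^ n).mulVec v = v} → A → ZMod p) :=
          ((Nat.bijective_iff_injective_and_card _).2
            ⟨Subtype.val_injective, h.trans hfun.symm⟩).2
        intro v
        obtain ⟨w, rfl⟩ := this v
        exact w.2
      exact Matrix.ext_of_mulVec_single fun b => by rw [hall, Matrix.one_mulVec]
    · rw [h, ← hfun]
      exact Nat.card_congr (Equiv.subtypeUnivEquiv fun v => Matrix.one_mulVec v)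
  constructor
  -- `Nat.card` is `0` on infinite types, so the fixed vector `0` forces finiteness.
  · refine Nat.finite_of_card_ne_zero ?_
    rw [hcard]
    have : Nonempty {v : A → ZMod p // (M ^ n).mulVec v = v} := ⟨0, Matrix.mulVec_zero _⟩
    exact Nat.card_pos.ne'
  · rw [hcard, hfix, hunit]
    -- Here `1 ≤ n` matters; conversely, an idempotent unit is `1`.
    refine ⟨fun h => IsUnit.of_pow_eq_one h (by omega), fun h => ?_⟩
    exact (IsIdempotentElem.iff_eq_one_of_isUnit (h.pow n)).1 hidem

end Incidence

/-! ### Comparing two primes -/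

theorem corollary4p4 {A : Type v} [Fintype A] [DecidableEq A]
    (φ : FreeGroup A →* FreeGroup A) (G : ProfiniteGrp.{u})
    (hG : DefinesOmegaPresentation φ G)
    (hdet : 1 < |(incidenceMatrix φ).det|) :
    ¬ IsFreeProfiniteGroup.{u, w} G := by
  rintro ⟨X, _, x₀, ι, hfree⟩
  have hfin : Finite (Clopens X) := by
    have : Fact (Nat.Prime 2) := ⟨Nat.prime_two⟩
    have := (hG.card_hom_zmod 2).1
    have : Nontrivial (Multiplicative (ZMod 2)) := inferInstanceAs (Nontrivial (ZMod 2))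
    have : Finite {f : C(X, Multiplicative (ZMod 2)) // f x₀ = 1} := by
      refine Nat.finite_of_card_ne_zero ?_
      rw [← hfree.card_hom]
      exact Nat.card_pos.ne'
    exact finite_clopens_of_finite_pointed x₀ (1 : Multiplicative (ZMod 2))
  obtain ⟨k, hk⟩ := exists_card_pointed_continuousMap_eq_pow x₀
  have hcard : ∀ p : ℕ, p.Prime →
      (k = Fintype.card A ↔ ¬ (p : ℤ) ∣ (incidenceMatrix φ).det) := by
    intro p hp
    have : Fact p.Prime := ⟨hp⟩
    have hpow : Nat.card (G →ₜ* Multiplicative (ZMod p)) = p ^ k := by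
      rw [hfree.card_hom, hk, Nat.card_congr Multiplicative.toAdd, Nat.card_zmod]
    rw [← (hG.card_hom_zmod p).2, hpow]
    exact (Nat.pow_right_injective hp.two_le).eq_iff.symm
  have hd : 1 < (incidenceMatrix φ).det.natAbs := by
    rwa [Int.abs_eq_natAbs, Nat.one_lt_cast] at hdet
  obtain ⟨p, hp, hpd⟩ := Nat.exists_prime_and_dvd hd.ne'
  -- A prime exceeding the nonzero `|det|` cannot divide it.
  obtain ⟨q, hq, hqp⟩ := Nat.exists_infinite_primes ((incidenceMatrix φ).det.natAbs + 1)
  refine (hcard p hp).1 ((hcard q hqp).2 fun h => ?_) (Int.natCast_dvd.2 hpd)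
  have := Nat.le_of_dvd (by omega) (Int.natCast_dvd.1 h)
  omega
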